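/- For $\nu\in\mathbb{R}$ and $-1<z\le 1$ let $P_\nu(z)={}_2F_1\!\left(-\nu,\nu+1;1;\tfrac{1-z}{2}\right)$ be the Legendre function of the first kind, and let $\mathsf{P}_4(z)=\left[\partial^4P_\nu(z)/\partial\nu^4\right]_{\nu=0}$. For real $x\le 1$ and $n\geq 2$ let $Li_n(x)$ be the real polylogarithm, i.e. $Li_1(x)=-\ln(1-x)$ for $x<1$ and $Li_{n}(x)=\int_0^x Li_{n-1}(u)\,\frac{du}{u}$; let $\zeta$ be the Riemann zeta function. For every $-1<z\le1$ the function $\nu\mapsto P_\nu(z)$ is four times continuously differentiable near $\nu=0$ (so that $\mathsf P_4(z)$ exists), and for $-1<z<1$, with $t=\frac{1+z}{2}\in(0,1)$, $$ \begin{aligned} \mathsf{P}_4(z)=\frac{\pi^4}{15}+24\Big[&\frac{\pi^4}{36}+\tfrac12 Li_2(t)^2-\tfrac{\pi^2}{6}Li_2(t)+2Li_4(t)-2Li_4(1-t)+2\ln(t)\big\{Li_3(1-t)-\zeta(3)\big\}\\ &+\tfrac1{12}\ln^4(1-t)+\tfrac{\pi^2}{6}\ln^2(1-t)+2Li_4\!\left(\tfrac{t}{t-1}\right)\\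 &+\ln(t)\ln(1-t)\big\{Li_2(t)-\tfrac{\pi^2}{2}-\tfrac13\ln^2(1-t)+\ln(t)\ln(1-t)\big\}\Big]. \end{aligned} $$ Moreover $\mathsf{P}_4(1)=0$ and $\mathsf{P}_4(z)\to0$ as $z\to1^-$ (hence the right-hand side tends to $0$ as $z\to1^-$, which is the condition that fixes its additive constant). -/

import Mathlib

/-- The Legendre function of the first kind `P_ν(z)` on the cut, of real order `ν`,
`P_ν(z) = ₂F₁(-ν, ν + 1; 1; (1 - z) / 2)`.  The hypergeometric series converges for
`-1 < z < 3`; only `-1 < z ≤ 1` is used. -/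
noncomputable def legendreP (ν z : ℝ) : ℝ :=
  ordinaryHypergeometric (-ν) (ν + 1) (1 : ℝ) ((1 - z) / 2)

/-- `𝖯ₙ(z)`, the `n`-th derivative of `P_ν(z)` with respect to the order `ν`, at `ν = 0`. -/
noncomputable def legendreOrderDeriv (n : ℕ) (z : ℝ) : ℝ :=
  iteratedDeriv n (fun ν : ℝ => legendreP ν z) 0

/-- The real polylogarithm `Li_n(x)` of natural order on the half line `x < 1` (and at `x = 1`
for `n ≥ 2`): `Li₀(x) = x / (1 - x)` and `Li_{n+1}(x) = ∫₀ˣ Li_n(u) / u du`.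
Hence `Li₁(x) = -ln(1 - x)`, and `Li_n(x) = ∑_{k ≥ 1} xᵏ / kⁿ` for `|x| < 1`; for `x ≤ -1` it is
the analytic continuation along the negative real axis. The integrand is bounded near `u = 0`. -/
noncomputable def polylog : ℕ → ℝ → ℝ
  | 0, x => x / (1 - x)
  | n + 1, x => ∫ u in (0 : ℝ)..x, polylog n u / u

/-!
Regrouping the factors of the Pochhammer symbols gives, with `x = (1 - z) / 2`,

`P_ν(z) = 1 - ∑_{k ≥ 1} (ν / k + ν² / k²) ∏_{1 ≤ j < k} (1 - ν² / j²) xᵏ`.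

For `0 ≤ x < 1` and complex `|ν| < 1` the coefficient of `xᵏ` is bounded by `2`, so the series
converges normally and may be differentiated in `ν` term by term. In the `k`-th term the coefficient
of `ν⁴` is `1 / k² * ∑_{j < k} 1 / j²`, hence `𝖯₄(z) = 24 Li_{2,2}(x)` with
`Li_{2,2}(x) = ∑_{k > j ≥ 1} xᵏ / (k² j²)` (`contDiffAt_legendreP_and_orderDeriv_four`). Since this
power series vanishes at `x = 0` and is continuous there, so does `𝖯₄` vanish at `z = 1` and tend to
`0` as `z → 1⁻`.

It remains to express `Li_{2,2}(1 - t)`, `0 < t < 1`, by classical polylogarithms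
(`polylogTwoTwo_one_sub`). Both sides have the same derivative: that of `Li_{2,2}` is
`Li_{1,2}(x) / x`, and `Li_{1,2}(1 - t)` is given by `polylogOneTwo_one_sub`; on the other side the
value `Li₃(t / (t - 1))` that appears is removed with the three-term relation of Landen for the
trilogarithm (`polylog_three_div_sub_one`), and `Li₂(1 - t)` with Euler's reflection formula
(`polylog_two_one_sub`). These relations are themselves proved by differentiation. The additive
constant is found at `t → 0⁺`, where all polylogarithms have finite limits and
`Li_{2,2}(1 - t) → ζ(2,2) = π⁴ / 120` (`hasSum_harmonicSq_div_sq`).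
-/

section LegendreSeries

open Set Filter Topology Polynomial

/-! ### Taylor coefficients of normally convergent series of polynomials -/

/-- The derivatives of all orders of a normally convergent series of polynomials on the complex unit
disc are obtained term by term, by Weierstrass's theorem. -/
theorem tendstoLocallyUniformlyOn_iteratedDeriv_tsum_aeval {T : ℕ → ℝ[X]} {u : ℕ → ℝ}
    (hu : Summable u)
    (hT : ∀ k, ∀ w ∈ Metric.ball (0 : ℂ) 1, ‖aeval w (T k)‖ ≤ u k) (n : ℕ) :
    TendstoLocallyUniformlyOn
      (fun (s : Finset ℕ) (w : ℂ) => ∑ k ∈ s, aeval w (derivative^[n] (T k)))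
      (iteratedDeriv n fun w : ℂ => ∑' k, aeval w (T k)) atTop (Metric.ball (0 : ℂ) 1) := by
  induction n with
  | zero =>
    simpa using (tendstoUniformlyOn_tsum hu hT).tendstoLocallyUniformlyOn
  | succ n ih =>
    have hd : ∀ p : ℝ[X], ∀ w : ℂ,
        HasDerivAt (fun w : ℂ => aeval w p) (aeval w (derivative p)) w :=
      fun p w => p.hasDerivAt_aeval w
    have h := ih.deriv (Eventually.of_forall fun s =>
      DifferentiableOn.fun_sum fun k _ w _ =>
        (hd (derivative^[n] (T k)) w).differentiableAt.differentiableWithinAt)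
      Metric.isOpen_ball
    rw [iteratedDeriv_succ]
    refine h.congr fun s w _ => ?_
    simp only [Function.comp_apply]
    rw [deriv_fun_sum fun k _ => (hd (derivative^[n] (T k)) w).differentiableAt]
    refine Finset.sum_congr rfl fun k _ => ?_
    rw [(hd _ w).deriv, Function.iterate_succ_apply']

theorem iteratedDeriv_re_comp_ofReal {F : ℂ → ℂ} {U : Set ℂ} (hU : IsOpen U)
    (hF : DifferentiableOn ℂ F U) (n : ℕ) {y : ℝ} (hy : (y : ℂ) ∈ U) :
    iteratedDeriv n (fun y : ℝ => (F y).re) y = (iteratedDeriv n F y).re := by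
  induction n generalizing y with
  | zero => simp
  | succ n ih =>
    have hev : iteratedDeriv n (fun y : ℝ => (F y).re) =ᶠ[𝓝 y]
        fun y : ℝ => (iteratedDeriv n F y).re := by
      filter_upwards [(hU.preimage Complex.continuous_ofReal).mem_nhds hy] with x hx using ih hx
    rw [iteratedDeriv_succ, iteratedDeriv_succ, hev.deriv_eq]
    have hA : AnalyticAt ℂ (iteratedDeriv n F) y := by
      rw [iteratedDeriv_eq_iterate]
      exact AnalyticAt.iterated_deriv (hF.analyticAt (hU.mem_nhds hy)) n
    exact hA.differentiableAt.hasDerivAt.real_of_complex.deriv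

/-- A series of real polynomials that converges normally on the complex unit disc is smooth at
the origin, and its Taylor coefficients there are the sums of the coefficients of its terms. -/
theorem contDiffAt_and_hasSum_coeff_of_norm_aeval_le {T : ℕ → ℝ[X]} {u : ℕ → ℝ}
    (hu : Summable u) (hT : ∀ k, ∀ w ∈ Metric.ball (0 : ℂ) 1, ‖aeval w (T k)‖ ≤ u k) (n : ℕ) :
    ContDiffAt ℝ n (fun y : ℝ => ∑' k, (T k).eval y) 0 ∧
      HasSum (fun k => (n.factorial : ℝ) * (T k).coeff n)
        (iteratedDeriv n (fun y : ℝ => ∑' k, (T k).eval y) 0) := by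
  set F : ℂ → ℂ := fun w => ∑' k, aeval w (T k) with hFdef
  have h0 : (0 : ℂ) ∈ Metric.ball (0 : ℂ) 1 := by simp
  have hF : DifferentiableOn ℂ F (Metric.ball 0 1) :=
    Complex.differentiableOn_tsum_of_summable_norm hu
      (fun k => (T k).differentiable_aeval.differentiableOn) Metric.isOpen_ball hT
  have hre : (fun y : ℝ => ∑' k, (T k).eval y) = fun y : ℝ => (F y).re := by
    funext y
    have : ∀ k, aeval (y : ℂ) (T k) = (((T k).eval y : ℝ) : ℂ) := fun k => by
      simpa using aeval_algebraMap_apply ℂ y (T k)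
    simp only [hFdef, this]
    rw [← Complex.ofReal_tsum, Complex.ofReal_re]
  rw [hre]
  constructor
  · have hA : AnalyticAt ℂ F ((0 : ℝ) : ℂ) := by
      simpa using hF.analyticAt (Metric.isOpen_ball.mem_nhds h0)
    exact hA.contDiffAt.real_of_complex
  · rw [iteratedDeriv_re_comp_ofReal Metric.isOpen_ball hF n (by simp)]
    have h := (tendstoLocallyUniformlyOn_iteratedDeriv_tsum_aeval hu hT n).tendsto_at h0
    have h' := (Complex.continuous_re.tendsto _).comp h
    have hfun : (Complex.re ∘ fun s : Finset ℕ => ∑ k ∈ s, aeval (0 : ℂ) (derivative^[n] (T k)))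
        = fun s => ∑ k ∈ s, (n.factorial : ℝ) * (T k).coeff n := by
      funext s
      simp only [Function.comp_apply, Complex.re_sum]
      refine Finset.sum_congr rfl fun k _ => ?_
      have h1 : aeval (0 : ℂ) (derivative^[n] (T k))
          = (((derivative^[n] (T k)).eval 0 : ℝ) : ℂ) := by
        simpa using aeval_algebraMap_apply ℂ (0 : ℝ) (derivative^[n] (T k))
      rw [h1, Complex.ofReal_re, ← coeff_zero_eq_eval_zero, coeff_iterate_derivative]
      simp [Nat.descFactorial_self]
    rw [hfun] at h'
    simpa [HasSum] using h'

/-! ### The hypergeometric series as a function of the order -/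

/-- The coefficient of `x ^ (k + 1)` in the hypergeometric series of `P_ν`, as a polynomial in `ν`:
`-(ν / (k + 1) + ν ^ 2 / (k + 1) ^ 2) * ∏_{1 ≤ j ≤ k} (1 - ν ^ 2 / j ^ 2)`. -/
noncomputable def legendreCoeffPoly (k : ℕ) : ℝ[X] :=
  -(C (1 / ((k : ℝ) + 1)) * X + C (1 / ((k : ℝ) + 1) ^ 2) * X ^ 2) *
    ∏ j ∈ Finset.range k, (1 - C (1 / ((j : ℝ) + 1) ^ 2) * X ^ 2)

/-- The second-order harmonic number `∑_{1 ≤ j ≤ k} 1 / j ^ 2`. -/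
noncomputable def harmonicSq (k : ℕ) : ℝ := ∑ j ∈ Finset.range k, 1 / ((j : ℝ) + 1) ^ 2

/-- Since `(-ν)_k (ν + 1)_k = ∏_{j < k} (j - ν) (j + 1 + ν)`, regrouping the factors as
`(j - ν) (j + ν)` with `1 ≤ j < k` leaves only `-ν` and `k + ν` unpaired. -/
theorem hypergeometricCoefficient_eq_eval_legendreCoeffPoly (ν : ℝ) (k : ℕ) :
    ordinaryHypergeometricCoefficient (-ν) (ν + 1) (1 : ℝ) (k + 1) =
      (legendreCoeffPoly k).eval ν := by
  induction k with
  | zero =>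
    simp [ordinaryHypergeometricCoefficient, legendreCoeffPoly, ascPochhammer_one]
    ring
  | succ k ih =>
    have hstep : ordinaryHypergeometricCoefficient (-ν) (ν + 1) (1 : ℝ) (k + 1 + 1) =
        ordinaryHypergeometricCoefficient (-ν) (ν + 1) (1 : ℝ) (k + 1) *
          ((-ν + (k + 1)) * (ν + 1 + (k + 1)) / ((k : ℝ) + 2) ^ 2) := by
      have hf : ((k + 1).factorial : ℝ) ≠ 0 := by positivity
      have hk : ((k : ℝ) + 2) ≠ 0 := by positivity
      simp only [ordinaryHypergeometricCoefficient]
      rw [ascPochhammer_succ_eval (k + 1) (-ν), ascPochhammer_succ_eval (k + 1) (ν + 1),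
        ascPochhammer_eval_one, ascPochhammer_eval_one, Nat.factorial_succ (k + 1)]
      push_cast
      have hk' : ((k : ℝ) + 1 + 1) ≠ 0 := by positivity
      field_simp
      ring
    rw [hstep, ih]
    simp only [legendreCoeffPoly, eval_mul, eval_neg, eval_add, eval_C, eval_X, eval_pow,
      Finset.prod_range_succ, eval_sub, eval_one]
    generalize eval ν (∏ j ∈ Finset.range k, (1 - C (1 / ((j : ℝ) + 1) ^ 2) * X ^ 2)) = p
    push_cast
    have h1 : ((k : ℝ) + 1) ≠ 0 := by positivity
    have h2 : ((k : ℝ) + 2) ≠ 0 := by positivity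
    have h3 : ((k : ℝ) + 1 + 1) ≠ 0 := by positivity
    field_simp
    ring

/-- The expansion of the product modulo `X ^ 4`. -/
theorem exists_prod_one_sub_sq_eq (k : ℕ) :
    ∃ R : ℝ[X], ∏ j ∈ Finset.range k, (1 - C (1 / ((j : ℝ) + 1) ^ 2) * X ^ 2) =
      1 - C (harmonicSq k) * X ^ 2 + X ^ 4 * R := by
  induction k with
  | zero => exact ⟨0, by simp [harmonicSq]⟩
  | succ k ih =>
    obtain ⟨R, hR⟩ := ih
    refine ⟨R + C (harmonicSq k) * C (1 / ((k : ℝ) + 1) ^ 2)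
      - C (1 / ((k : ℝ) + 1) ^ 2) * X ^ 2 * R, ?_⟩
    have hH : harmonicSq (k + 1) = harmonicSq k + 1 / ((k : ℝ) + 1) ^ 2 :=
      Finset.sum_range_succ _ k
    rw [Finset.prod_range_succ, hR, hH, C_add]
    ring

theorem coeff_four_legendreCoeffPoly (k : ℕ) :
    (legendreCoeffPoly k).coeff 4 = harmonicSq k / ((k : ℝ) + 1) ^ 2 := by
  obtain ⟨R, hR⟩ := exists_prod_one_sub_sq_eq k
  set a : ℝ := 1 / ((k : ℝ) + 1)
  set b : ℝ := 1 / ((k : ℝ) + 1) ^ 2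
  have h : legendreCoeffPoly k = C (-a) * X ^ 1 + C (-b) * X ^ 2 + C (a * harmonicSq k) * X ^ 3
      + C (b * harmonicSq k) * X ^ 4 + X ^ 5 * (-(C a + C b * X) * R) := by
    rw [legendreCoeffPoly, hR]
    simp only [C_neg, C_mul]
    ring
  rw [h]
  simp only [coeff_add, coeff_C_mul_X_pow, coeff_X_pow_mul']
  norm_num
  simp only [b]
  ring

/-- The product is at most `k + 1` in absolute value, which the factor `1 / (k + 1)` compensates, so
the bound is uniform in `k`. -/
theorem norm_aeval_legendreCoeffPoly_le (k : ℕ) {w : ℂ} (hw : ‖w‖ ≤ 1) :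
    ‖aeval w (legendreCoeffPoly k)‖ ≤ 2 := by
  have hp : ‖∏ j ∈ Finset.range k, (1 - ((1 / ((j : ℝ) + 1) ^ 2 : ℝ) : ℂ) * w ^ 2)‖
      ≤ (k : ℝ) + 1 := by
    induction k with
    | zero => simp
    | succ k ih =>
      rw [Finset.prod_range_succ, norm_mul]
      have h1 : ‖1 - ((1 / ((k : ℝ) + 1) ^ 2 : ℝ) : ℂ) * w ^ 2‖ ≤ 1 + 1 / ((k : ℝ) + 1) ^ 2 := by
        refine (norm_sub_le _ _).trans ?_
        rw [norm_one, norm_mul, norm_pow, Complex.norm_real, Real.norm_of_nonneg (by positivity)]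
        gcongr
        exact mul_le_of_le_one_right (by positivity) (pow_le_one₀ (norm_nonneg _) hw)
      refine (mul_le_mul ih h1 (norm_nonneg _) (by positivity)).trans ?_
      -- the factor `1 + 1 / (k + 1) ^ 2` is at most `(k + 2) / (k + 1)`, so the bound telescopes
      have hk : ((k : ℝ) + 1) * (1 + 1 / ((k : ℝ) + 1) ^ 2) = k + 1 + 1 / ((k : ℝ) + 1) := by
        field_simp
      rw [hk]
      push_cast
      gcongr
      exact (div_le_one (by positivity)).2 (by linarith [(Nat.cast_nonneg k : (0 : ℝ) ≤ k)])
  have hl : ‖((1 / ((k : ℝ) + 1) : ℝ) : ℂ) * w + ((1 / ((k : ℝ) + 1) ^ 2 : ℝ) : ℂ) * w ^ 2‖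
      ≤ 1 / ((k : ℝ) + 1) + 1 / ((k : ℝ) + 1) ^ 2 := by
    refine (norm_add_le _ _).trans ?_
    rw [norm_mul, norm_mul, norm_pow, Complex.norm_real, Complex.norm_real,
      Real.norm_of_nonneg (by positivity), Real.norm_of_nonneg (by positivity)]
    gcongr
    · exact mul_le_of_le_one_right (by positivity) hw
    · exact mul_le_of_le_one_right (by positivity) (pow_le_one₀ (norm_nonneg _) hw)
  have heq : aeval w (legendreCoeffPoly k) =
      -(((1 / ((k : ℝ) + 1) : ℝ) : ℂ) * w + ((1 / ((k : ℝ) + 1) ^ 2 : ℝ) : ℂ) * w ^ 2) *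
        ∏ j ∈ Finset.range k, (1 - ((1 / ((j : ℝ) + 1) ^ 2 : ℝ) : ℂ) * w ^ 2) := by
    simp only [legendreCoeffPoly, map_mul, map_neg, map_add, map_prod, map_sub, map_one, map_pow,
      aeval_C, aeval_X, Complex.coe_algebraMap]
  rw [heq, norm_mul, norm_neg]
  refine (mul_le_mul hl hp (norm_nonneg _) (by positivity)).trans ?_
  have hk : (1 / ((k : ℝ) + 1) + 1 / ((k : ℝ) + 1) ^ 2) * (k + 1) = 1 + 1 / ((k : ℝ) + 1) := by
    field_simp
  rw [hk]
  have : 1 / ((k : ℝ) + 1) ≤ 1 :=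
    (div_le_one (by positivity)).2 (by linarith [(Nat.cast_nonneg k : (0 : ℝ) ≤ k)])
  linarith

theorem legendreP_eq_one_add_tsum {z : ℝ} (hz : -1 < z) (hz' : z ≤ 1) {ν : ℝ} (hν : |ν| ≤ 1) :
    legendreP ν z =
      1 + ∑' k, (C (((1 - z) / 2) ^ (k + 1)) * legendreCoeffPoly k).eval ν := by
  have hx0 : 0 ≤ (1 - z) / 2 := by linarith
  have hx1 : (1 - z) / 2 < 1 := by linarith
  set x := (1 - z) / 2 with hx
  have hterm : ∀ k, (ordinaryHypergeometricCoefficient (-ν) (ν + 1) (1 : ℝ) (k + 1)) • x ^ (k + 1)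
      = (C (x ^ (k + 1)) * legendreCoeffPoly k).eval ν := fun k => by
    rw [hypergeometricCoefficient_eq_eval_legendreCoeffPoly, eval_mul, eval_C, smul_eq_mul,
      mul_comm]
  have hsum : Summable fun k => (C (x ^ (k + 1)) * legendreCoeffPoly k).eval ν := by
    refine Summable.of_norm_bounded (g := fun k => x ^ (k + 1) * 2)
      (((summable_nat_add_iff 1).2 (summable_geometric_of_lt_one hx0 hx1)).mul_right 2)
      fun k => ?_
    have h := norm_aeval_legendreCoeffPoly_le k (w := (ν : ℂ)) (by simpa using hν)
    have h2 : aeval (ν : ℂ) (legendreCoeffPoly k) = (((legendreCoeffPoly k).eval ν : ℝ) : ℂ) := by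
      simpa using aeval_algebraMap_apply ℂ ν (legendreCoeffPoly k)
    rw [h2, Complex.norm_real] at h
    rw [eval_mul, eval_C, norm_mul, Real.norm_of_nonneg (by positivity)]
    gcongr
  rw [legendreP, ordinaryHypergeometric_eq_tsum]
  simp only [← hx]
  change ∑' n, (ordinaryHypergeometricCoefficient (-ν) (ν + 1) (1 : ℝ) n) • x ^ n = _
  have hs' : Summable fun n =>
      (ordinaryHypergeometricCoefficient (-ν) (ν + 1) (1 : ℝ) n) • x ^ n := by
    rw [← summable_nat_add_iff 1]
    simpa only [hterm] using hsum
  rw [hs'.tsum_eq_zero_add]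
  simp only [hterm]
  simp [ordinaryHypergeometricCoefficient]

/-- The derivatives of `P_ν(z)` in the order at `ν = 0` can be taken term by term in the
hypergeometric series; the fourth one is `24` times the multiple polylogarithm
`Li_{2,2}((1 - z) / 2)`. -/
theorem contDiffAt_legendreP_and_orderDeriv_four {z : ℝ} (hz : -1 < z) (hz' : z ≤ 1) :
    ContDiffAt ℝ 4 (fun ν : ℝ => legendreP ν z) 0 ∧
      legendreOrderDeriv 4 z =
        24 * ∑' k, harmonicSq k / ((k : ℝ) + 1) ^ 2 * ((1 - z) / 2) ^ (k + 1) := by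
  have hx0 : 0 ≤ (1 - z) / 2 := by linarith
  have hx1 : (1 - z) / 2 < 1 := by linarith
  set x := (1 - z) / 2 with hx
  obtain ⟨hc, hd⟩ := contDiffAt_and_hasSum_coeff_of_norm_aeval_le
    (T := fun k => C (x ^ (k + 1)) * legendreCoeffPoly k) (u := fun k => x ^ (k + 1) * 2)
    (((summable_nat_add_iff 1).2 (summable_geometric_of_lt_one hx0 hx1)).mul_right 2)
    (fun k w hw => by
      rw [map_mul, aeval_C, norm_mul, norm_algebraMap', Real.norm_of_nonneg (by positivity)]
      gcongr
      exact norm_aeval_legendreCoeffPoly_le k (by simpa using (mem_ball_zero_iff.1 hw).le)) 4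
  have hev : (fun ν : ℝ => legendreP ν z) =ᶠ[𝓝 0] fun ν : ℝ =>
      1 + ∑' k, (C (x ^ (k + 1)) * legendreCoeffPoly k).eval ν := by
    filter_upwards [Metric.closedBall_mem_nhds (0 : ℝ) one_pos] with ν hν
    exact legendreP_eq_one_add_tsum hz hz' (by simpa using hν)
  refine ⟨(contDiffAt_const.add hc).congr_of_eventuallyEq hev, ?_⟩
  rw [legendreOrderDeriv, hev.iteratedDeriv_eq, iteratedDeriv_const_add (by norm_num), ← hd.tsum_eq,
    ← tsum_mul_left]
  refine tsum_congr fun k => ?_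
  rw [coeff_C_mul, coeff_four_legendreCoeffPoly]
  simp [Nat.factorial]
  ring

end LegendreSeries

section Polylogarithms

open Set Filter Topology

/-! ### Derivatives and power series of polylogarithms -/

theorem polylog_zero (n : ℕ) : polylog n 0 = 0 := by cases n <;> simp [polylog]

theorem dslope_polylog_of_ne (n : ℕ) {x : ℝ} (hx : x ≠ 0) :
    dslope (polylog n) 0 x = polylog n x / x := by
  rw [dslope_of_ne _ hx, slope_def_field, polylog_zero, sub_zero, sub_zero]

/-- The integrand `polylog n u / u`, which Lean evaluates to `0` at `u = 0`, may be replaced by its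
continuous extension, the slope function of `polylog n` at `0`. -/
theorem polylog_succ_eq_integral_dslope (n : ℕ) (x : ℝ) :
    polylog (n + 1) x = ∫ u in (0 : ℝ)..x, dslope (polylog n) 0 u := by
  rw [polylog]
  refine intervalIntegral.integral_congr_ae ?_
  filter_upwards [MeasureTheory.Measure.ae_ne MeasureTheory.volume (0 : ℝ)] with u hu _
  rw [dslope_polylog_of_ne n hu]

theorem hasDerivAt_integral_of_continuousOn_Iio {g : ℝ → ℝ} (hg : ContinuousOn g (Iio 1)) {x : ℝ}
    (hx : x < 1) : HasDerivAt (fun y => ∫ u in (0 : ℝ)..y, g u) (g x) x := by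
  have hsub : uIcc 0 x ⊆ Iio 1 := fun y hy => lt_of_le_of_lt hy.2 (max_lt one_pos hx)
  exact intervalIntegral.integral_hasDerivAt_right (hg.mono hsub).intervalIntegrable
    (hg.stronglyMeasurableAtFilter isOpen_Iio x hx) (hg.continuousAt (Iio_mem_nhds hx))

theorem differentiableOn_polylog (n : ℕ) : DifferentiableOn ℝ (polylog n) (Iio 1) := by
  induction n with
  | zero =>
    have h : polylog 0 = fun x => x / (1 - x) := by funext x; rw [polylog]
    rw [h]
    intro x hx
    have : (1 : ℝ) - x ≠ 0 := (sub_pos.2 hx).ne'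
    fun_prop (disch := assumption)
  | succ n ih =>
    intro x hx
    have hc : ContinuousOn (dslope (polylog n) 0) (Iio 1) :=
      (continuousOn_dslope (Iio_mem_nhds one_pos)).2
        ⟨ih.continuousOn, ih.differentiableAt (Iio_mem_nhds one_pos)⟩
    have h := hasDerivAt_integral_of_continuousOn_Iio hc hx
    simp only [← polylog_succ_eq_integral_dslope] at h
    exact h.differentiableAt.differentiableWithinAt

theorem continuousOn_dslope_polylog (n : ℕ) : ContinuousOn (dslope (polylog n) 0) (Iio 1) :=
  (continuousOn_dslope (Iio_mem_nhds one_pos)).2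
    ⟨(differentiableOn_polylog n).continuousOn,
      (differentiableOn_polylog n).differentiableAt (Iio_mem_nhds one_pos)⟩

theorem hasDerivAt_polylog_succ (n : ℕ) {x : ℝ} (hx : x < 1) (hx0 : x ≠ 0) :
    HasDerivAt (polylog (n + 1)) (polylog n x / x) x := by
  have h := hasDerivAt_integral_of_continuousOn_Iio (continuousOn_dslope_polylog n) hx
  rw [dslope_polylog_of_ne n hx0] at h
  simpa only [← polylog_succ_eq_integral_dslope] using h

theorem continuousAt_polylog (n : ℕ) {x : ℝ} (hx : x < 1) : ContinuousAt (polylog n) x :=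
  ((differentiableOn_polylog n).differentiableAt (Iio_mem_nhds hx)).continuousAt

/-- Termwise differentiation of a power series with bounded coefficients. -/
theorem hasDerivAt_tsum_div_mul_pow {c : ℕ → ℝ} {B : ℝ} (hc : ∀ k, |c k| ≤ B) {x : ℝ}
    (hx : |x| < 1) :
    HasDerivAt (fun y : ℝ => ∑' k, c k / ((k : ℝ) + 1) * y ^ (k + 1)) (∑' k, c k * x ^ k) x := by
  obtain ⟨r, hxr, hr⟩ := exists_between hx
  have hr0 : 0 < r := (abs_nonneg x).trans_lt hxr
  refine hasDerivAt_tsum_of_isPreconnected (g := fun k y => c k / ((k : ℝ) + 1) * y ^ (k + 1))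
    (g' := fun k y => c k * y ^ k) (u := fun k => B * r ^ k) (t := Ioo (-r) r) (y₀ := 0)
    ((summable_geometric_of_lt_one hr0.le hr).mul_left B) isOpen_Ioo isPreconnected_Ioo
    (fun k y _ => ?_) (fun k y hy => ?_) ⟨by linarith, hr0⟩
    (summable_zero.congr fun k => by rw [zero_pow k.succ_ne_zero, mul_zero])
    (abs_lt.1 hxr)
  · have h := (hasDerivAt_pow (k + 1) y).const_mul (c k / ((k : ℝ) + 1))
    refine h.congr_deriv ?_
    have : (k : ℝ) + 1 ≠ 0 := by positivity
    push_cast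
    field_simp
  · rw [Real.norm_eq_abs, abs_mul, abs_pow]
    have : |y| ≤ r := (abs_lt.2 hy).le
    exact mul_le_mul (hc k) (by gcongr) (by positivity) ((abs_nonneg _).trans (hc k))

theorem polylog_one {x : ℝ} (hx : x < 1) : polylog 1 x = -Real.log (1 - x) := by
  have hd : ∀ y ∈ Iio (1 : ℝ), HasDerivAt (fun y => -Real.log (1 - y)) (1 / (1 - y)) y := by
    intro y hy
    have h1 : (1 : ℝ) - y ≠ 0 := (sub_pos.2 hy).ne'
    refine (((hasDerivAt_id y).const_sub 1).log h1).neg.congr_deriv ?_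
    rw [neg_div, neg_neg]
    rfl
  have hsub : uIcc 0 x ⊆ Iio 1 := fun y hy => lt_of_le_of_lt hy.2 (max_lt one_pos hx)
  have h0 : polylog 1 x = ∫ u in (0 : ℝ)..x, 1 / (1 - u) := by
    rw [polylog]
    refine intervalIntegral.integral_congr_ae ?_
    filter_upwards [MeasureTheory.Measure.ae_ne MeasureTheory.volume (0 : ℝ)] with u hu _
    rw [polylog]
    field_simp
  rw [h0, intervalIntegral.integral_eq_sub_of_hasDerivAt (fun y hy => hd y (hsub hy))]
  · simp
  · refine ContinuousOn.intervalIntegrable fun y hy => ?_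
    have h1 : (1 : ℝ) - y ≠ 0 := (sub_pos.2 (hsub hy)).ne'
    exact ContinuousAt.continuousWithinAt (by fun_prop (disch := assumption))

/-- The power series of the polylogarithm on `(-1, 1)`, integrated term by term from one order to the
next. -/
theorem polylog_eq_tsum (n : ℕ) {x : ℝ} (hx : |x| < 1) :
    polylog n x = ∑' k : ℕ, 1 / ((k : ℝ) + 1) ^ n * x ^ (k + 1) := by
  induction n generalizing x with
  | zero =>
    simp only [pow_zero, div_one, one_mul, pow_succ]
    rw [tsum_mul_right, tsum_geometric_of_abs_lt_one hx, polylog]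
    field_simp
  | succ n ih =>
    have hsub : uIcc 0 x ⊆ Ioo (-1) 1 := fun y hy =>
      ⟨(lt_min (by norm_num) (abs_lt.1 hx).1).trans_le hy.1,
        hy.2.trans_lt (max_lt one_pos (abs_lt.1 hx).2)⟩
    have hb : ∀ k : ℕ, |1 / ((k : ℝ) + 1) ^ n| ≤ 1 := fun k => by
      rw [abs_of_nonneg (by positivity)]
      refine (div_le_one (by positivity)).2 (one_le_pow₀ ?_)
      linarith [(Nat.cast_nonneg k : (0 : ℝ) ≤ k)]
    have hd : ∀ y ∈ uIcc 0 x,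
        HasDerivAt (fun y : ℝ => ∑' k : ℕ, 1 / ((k : ℝ) + 1) ^ (n + 1) * y ^ (k + 1))
          (∑' k : ℕ, 1 / ((k : ℝ) + 1) ^ n * y ^ k) y := by
      intro y hy
      have h := hasDerivAt_tsum_div_mul_pow hb (abs_lt.2 (hsub hy))
      simpa only [div_div, ← pow_succ] using h
    have hint : polylog (n + 1) x =
        ∫ y in (0 : ℝ)..x, ∑' k : ℕ, 1 / ((k : ℝ) + 1) ^ n * y ^ k := by
      rw [polylog]
      refine intervalIntegral.integral_congr_ae ?_
      filter_upwards [MeasureTheory.Measure.ae_ne MeasureTheory.volume (0 : ℝ)] with u hu hu'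
      rw [ih (abs_lt.2 (hsub (uIoc_subset_uIcc hu'))), ← tsum_div_const]
      refine tsum_congr fun k => ?_
      field_simp
      ring
    rw [hint, intervalIntegral.integral_eq_sub_of_hasDerivAt hd]
    · simp
    · have hi : IntervalIntegrable (dslope (polylog n) 0) MeasureTheory.volume 0 x :=
        ((continuousOn_dslope_polylog n).mono fun y hy => (hsub hy).2).intervalIntegrable
      refine hi.congr_ae ?_
      filter_upwards [MeasureTheory.ae_restrict_of_ae
        (MeasureTheory.Measure.ae_ne MeasureTheory.volume (0 : ℝ)),
        MeasureTheory.ae_restrict_mem measurableSet_uIoc] with u hu hu'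
      rw [dslope_polylog_of_ne n hu, ih (abs_lt.2 (hsub (uIoc_subset_uIcc hu'))),
        ← tsum_div_const]
      refine tsum_congr fun k => ?_
      field_simp
      ring

/-! ### Limits at the endpoints -/

theorem tendsto_one_sub_nhdsGT_zero : Tendsto (fun t : ℝ => 1 - t) (𝓝[>] 0) (𝓝[<] 1) := by
  refine tendsto_nhdsWithin_iff.2 ⟨?_, ?_⟩
  · have : Tendsto (fun t : ℝ => 1 - t) (𝓝 0) (𝓝 (1 - 0)) := by
      exact (continuous_const.sub continuous_id).tendsto 0
    simpa using this.mono_left nhdsWithin_le_nhds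
  · filter_upwards [self_mem_nhdsWithin] with t (ht : 0 < t)
    exact sub_lt_self 1 ht

/-- Abel's limit theorem, for a summable sequence of nonnegative coefficients. -/
theorem tendsto_tsum_mul_pow_nhdsLT_one {c : ℕ → ℝ} (hc : Summable c) (hc0 : ∀ k, 0 ≤ c k) :
    Tendsto (fun x : ℝ => ∑' k, c k * x ^ (k + 1)) (𝓝[<] 1) (𝓝 (∑' k, c k)) := by
  have h : ContinuousOn (fun x : ℝ => ∑' k, c k * x ^ (k + 1)) (Icc 0 1) := by
    refine continuousOn_tsum (u := c) (fun k => by fun_prop) hc fun k x hx => ?_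
    rw [Real.norm_of_nonneg (mul_nonneg (hc0 k) (pow_nonneg hx.1 _))]
    exact mul_le_of_le_one_right (hc0 k) (pow_le_one₀ hx.1 hx.2)
  have h1 := (h 1 ⟨zero_le_one, le_rfl⟩).tendsto.mono_left
    (nhdsWithin_le_of_mem (Icc_mem_nhdsLT zero_lt_one))
  simpa using h1

theorem summable_one_div_succ_pow {n : ℕ} (hn : 1 < n) :
    Summable fun k : ℕ => 1 / ((k : ℝ) + 1) ^ n := by
  simpa using (summable_nat_add_iff 1).2 (Real.summable_one_div_nat_pow.2 hn)

theorem tendsto_polylog_nhdsLT_one {n : ℕ} (hn : 1 < n) :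
    Tendsto (polylog n) (𝓝[<] 1) (𝓝 (∑' k : ℕ, 1 / ((k : ℝ) + 1) ^ n)) := by
  refine (tendsto_tsum_mul_pow_nhdsLT_one (summable_one_div_succ_pow hn)
    fun k => by positivity).congr' ?_
  filter_upwards [Ioo_mem_nhdsLT (zero_lt_one' ℝ)] with x hx
  rw [polylog_eq_tsum n (abs_lt.2 ⟨by linarith [hx.1], hx.2⟩)]

theorem hasSum_one_div_succ_sq :
    HasSum (fun k : ℕ => 1 / ((k : ℝ) + 1) ^ 2) (Real.pi ^ 2 / 6) := by
  simpa using (hasSum_nat_add_iff' 1).2 hasSum_zeta_two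

theorem hasSum_one_div_succ_pow_four :
    HasSum (fun k : ℕ => 1 / ((k : ℝ) + 1) ^ 4) (Real.pi ^ 4 / 90) := by
  simpa using (hasSum_nat_add_iff' 1).2 hasSum_zeta_four

theorem tsum_one_div_succ_pow_three :
    ∑' k : ℕ, 1 / ((k : ℝ) + 1) ^ 3 = (riemannZeta 3).re := by
  have h := zeta_nat_eq_tsum_of_gt_one (k := 3) (by norm_num)
  have h2 : (∑' n : ℕ, 1 / (n : ℂ) ^ 3) = ((∑' n : ℕ, 1 / (n : ℝ) ^ 3 : ℝ) : ℂ) := by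
    push_cast
    rfl
  rw [h2] at h
  push_cast at h
  have h3 : (riemannZeta 3).re = ∑' n : ℕ, 1 / (n : ℝ) ^ 3 := by
    rw [show riemannZeta 3 = ((∑' n : ℕ, 1 / (n : ℝ) ^ 3 : ℝ) : ℂ) by rw [h]; push_cast; rfl,
      Complex.ofReal_re]
  rw [h3, (Real.summable_one_div_nat_pow.2 (by norm_num : 1 < 3)).tsum_eq_zero_add]
  simp

theorem tendsto_polylog_two_nhdsLT_one :
    Tendsto (polylog 2) (𝓝[<] 1) (𝓝 (Real.pi ^ 2 / 6)) := by
  simpa only [hasSum_one_div_succ_sq.tsum_eq] using tendsto_polylog_nhdsLT_one one_lt_two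

theorem tendsto_polylog_three_nhdsLT_one :
    Tendsto (polylog 3) (𝓝[<] 1) (𝓝 (riemannZeta 3).re) := by
  simpa only [tsum_one_div_succ_pow_three] using
    tendsto_polylog_nhdsLT_one (n := 3) (by norm_num)

theorem tendsto_polylog_four_nhdsLT_one :
    Tendsto (polylog 4) (𝓝[<] 1) (𝓝 (Real.pi ^ 4 / 90)) := by
  simpa only [hasSum_one_div_succ_pow_four.tsum_eq] using
    tendsto_polylog_nhdsLT_one (n := 4) (by norm_num)

theorem tendsto_log_mul_id_nhdsGT_zero :
    Tendsto (fun t : ℝ => Real.log t * t) (𝓝[>] 0) (𝓝 0) := by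
  simpa using tendsto_log_mul_rpow_nhdsGT_zero zero_lt_one

theorem tendsto_log_mul_log_one_sub :
    Tendsto (fun t : ℝ => Real.log t * Real.log (1 - t)) (𝓝[>] 0) (𝓝 0) := by
  have hd : HasDerivAt (fun t : ℝ => Real.log (1 - t)) (-1 / (1 - 0)) 0 :=
    ((hasDerivAt_id (0 : ℝ)).const_sub 1).log (by norm_num)
  have hO := hd.isBigO_sub.mono (nhdsWithin_le_nhds (s := Ioi 0))
  simp only [sub_zero, Real.log_one] at hO
  exact ((Asymptotics.isBigO_refl Real.log _).mul hO).trans_tendsto tendsto_log_mul_id_nhdsGT_zero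

/-- The trilogarithm approaches `ζ(3)` linearly at `1`, fast enough to absorb the factor `log t` in
`tendsto_log_mul_polylog_three_one_sub`. -/
theorem abs_polylog_three_one_sub_sub_zeta_le {t : ℝ} (ht : t ∈ Ioo (0 : ℝ) 1) :
    |polylog 3 (1 - t) - (riemannZeta 3).re| ≤ Real.pi ^ 2 / 6 * t := by
  have h3 := summable_one_div_succ_pow (n := 3) (by norm_num)
  have hx : |1 - t| < 1 := abs_lt.2 ⟨by linarith [ht.2], by linarith [ht.1]⟩
  have hs : Summable fun k : ℕ => 1 / ((k : ℝ) + 1) ^ 3 * (1 - t) ^ (k + 1) := by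
    refine h3.of_nonneg_of_le (fun k => ?_) fun k => ?_
    · exact mul_nonneg (by positivity) (pow_nonneg (by linarith [ht.2]) _)
    · exact mul_le_of_le_one_right (by positivity)
        (pow_le_one₀ (by linarith [ht.2]) (by linarith [ht.1]))
  have heq : (riemannZeta 3).re - polylog 3 (1 - t) =
      ∑' k : ℕ, 1 / ((k : ℝ) + 1) ^ 3 * (1 - (1 - t) ^ (k + 1)) := by
    rw [polylog_eq_tsum 3 hx, ← tsum_one_div_succ_pow_three, ← h3.tsum_sub hs]
    simp only [mul_sub, mul_one]
  have hpow : ∀ k : ℕ, (1 - t) ^ (k + 1) ≤ 1 := fun k =>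
    pow_le_one₀ (by linarith [ht.2]) (by linarith [ht.1])
  rw [abs_sub_comm, heq, abs_of_nonneg (tsum_nonneg fun k =>
    mul_nonneg (by positivity) (sub_nonneg.2 (hpow k))),
    ← hasSum_one_div_succ_sq.tsum_eq, ← tsum_mul_right]
  refine Summable.tsum_le_tsum (fun k => ?_) ?_ (hasSum_one_div_succ_sq.summable.mul_right t)
  · -- Bernoulli's inequality
    have hB := one_add_mul_le_pow (a := -t) (by linarith [ht.2]) (k + 1)
    push_cast at hB
    have h1 : 1 - (1 - t) ^ (k + 1) ≤ ((k : ℝ) + 1) * t := by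
      rw [sub_eq_add_neg 1 t]
      linarith
    calc 1 / ((k : ℝ) + 1) ^ 3 * (1 - (1 - t) ^ (k + 1))
        ≤ 1 / ((k : ℝ) + 1) ^ 3 * (((k : ℝ) + 1) * t) := by gcongr
      _ = 1 / ((k : ℝ) + 1) ^ 2 * t := by field_simp
  · simpa only [mul_sub, mul_one] using h3.sub hs

theorem tendsto_log_mul_polylog_three_one_sub :
    Tendsto (fun t : ℝ => Real.log t * (polylog 3 (1 - t) - (riemannZeta 3).re))
      (𝓝[>] 0) (𝓝 0) := by
  have hO : (fun t : ℝ => polylog 3 (1 - t) - (riemannZeta 3).re) =O[𝓝[>] 0] fun t => t := by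
    refine Asymptotics.IsBigO.of_bound (Real.pi ^ 2 / 6) ?_
    filter_upwards [Ioo_mem_nhdsGT (zero_lt_one' ℝ)] with t ht
    rw [Real.norm_eq_abs, Real.norm_of_nonneg ht.1.le]
    exact abs_polylog_three_one_sub_sub_zeta_le ht
  exact ((Asymptotics.isBigO_refl Real.log _).mul hO).trans_tendsto tendsto_log_mul_id_nhdsGT_zero

/-! ### The multiple polylogarithms of weights three and four -/

theorem harmonicSq_succ (k : ℕ) : harmonicSq (k + 1) = harmonicSq k + 1 / ((k : ℝ) + 1) ^ 2 :=
  Finset.sum_range_succ _ k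

theorem harmonicSq_nonneg (k : ℕ) : 0 ≤ harmonicSq k :=
  Finset.sum_nonneg fun _ _ => by positivity

theorem harmonicSq_le (k : ℕ) : harmonicSq k ≤ Real.pi ^ 2 / 6 :=
  sum_le_hasSum _ (fun _ _ => by positivity) hasSum_one_div_succ_sq

/-- `Li_{1,2}(x) = ∑_{k > j ≥ 1} x ^ k / (k * j ^ 2)`. -/
noncomputable def polylogOneTwo (x : ℝ) : ℝ := ∑' k, harmonicSq k / ((k : ℝ) + 1) * x ^ (k + 1)

/-- `Li_{2,2}(x) = ∑_{k > j ≥ 1} x ^ k / (k ^ 2 * j ^ 2)`. -/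
noncomputable def polylogTwoTwo (x : ℝ) : ℝ :=
  ∑' k, harmonicSq k / ((k : ℝ) + 1) ^ 2 * x ^ (k + 1)

/-- Multiplication by `1 - x` turns the coefficients `harmonicSq k` into their differences
`1 / k ^ 2`. -/
theorem tsum_harmonicSq_mul_pow {x : ℝ} (hx : |x| < 1) :
    ∑' k, harmonicSq k * x ^ k = polylog 2 x / (1 - x) := by
  have hg : Summable fun k : ℕ => |x| ^ k := summable_geometric_of_lt_one (abs_nonneg x) hx
  have hs : Summable fun k => harmonicSq k * x ^ k := by
    refine Summable.of_norm_bounded (hg.mul_left (Real.pi ^ 2 / 6)) fun k => ?_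
    rw [norm_mul, norm_pow, Real.norm_of_nonneg (harmonicSq_nonneg k), Real.norm_eq_abs]
    gcongr
    exact harmonicSq_le k
  have hp : Summable fun k : ℕ => 1 / ((k : ℝ) + 1) ^ 2 * x ^ (k + 1) := by
    refine Summable.of_norm_bounded (hasSum_one_div_succ_sq.summable) fun k => ?_
    rw [norm_mul, norm_pow, Real.norm_of_nonneg (by positivity), Real.norm_eq_abs]
    exact mul_le_of_le_one_right (by positivity) (pow_le_one₀ (abs_nonneg x) hx.le)
  have h1 : ∑' k, harmonicSq k * x ^ k = x * ∑' k, harmonicSq k * x ^ k + polylog 2 x := by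
    conv_lhs => rw [hs.tsum_eq_zero_add]
    rw [polylog_eq_tsum 2 hx, ← tsum_mul_left, ← (hs.mul_left x).tsum_add hp]
    rw [show harmonicSq 0 = 0 by simp [harmonicSq], zero_mul, zero_add]
    refine tsum_congr fun k => ?_
    rw [harmonicSq_succ]
    ring
  rw [eq_div_iff (sub_pos.2 (abs_lt.1 hx).2).ne']
  linarith

theorem hasDerivAt_polylogOneTwo {x : ℝ} (hx : |x| < 1) :
    HasDerivAt polylogOneTwo (polylog 2 x / (1 - x)) x := by
  rw [← tsum_harmonicSq_mul_pow hx]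
  exact hasDerivAt_tsum_div_mul_pow
    (fun k => by rw [abs_of_nonneg (harmonicSq_nonneg k)]; exact harmonicSq_le k) hx

theorem hasDerivAt_polylogTwoTwo_tsum {x : ℝ} (hx : |x| < 1) :
    HasDerivAt polylogTwoTwo (∑' k, harmonicSq k / ((k : ℝ) + 1) * x ^ k) x := by
  have hb : ∀ k : ℕ, |harmonicSq k / ((k : ℝ) + 1)| ≤ Real.pi ^ 2 / 6 := fun k => by
    rw [abs_of_nonneg (div_nonneg (harmonicSq_nonneg k) (by positivity))]
    refine (div_le_self (harmonicSq_nonneg k) ?_).trans (harmonicSq_le k)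
    linarith [(Nat.cast_nonneg k : (0 : ℝ) ≤ k)]
  have h : polylogTwoTwo =
      fun y => ∑' k, harmonicSq k / ((k : ℝ) + 1) / ((k : ℝ) + 1) * y ^ (k + 1) := by
    funext y
    simp only [polylogTwoTwo, div_div, ← pow_two]
  rw [h]
  exact hasDerivAt_tsum_div_mul_pow hb hx

theorem hasDerivAt_polylogTwoTwo {x : ℝ} (hx : |x| < 1) (hx0 : x ≠ 0) :
    HasDerivAt polylogTwoTwo (polylogOneTwo x / x) x := by
  have h : polylogOneTwo x / x = ∑' k, harmonicSq k / ((k : ℝ) + 1) * x ^ k := by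
    rw [polylogOneTwo, ← tsum_div_const]
    refine tsum_congr fun k => ?_
    field_simp
    ring
  rw [h]
  exact hasDerivAt_polylogTwoTwo_tsum hx

/-- `ζ(2,2) = (ζ(2) ^ 2 - ζ(4)) / 2 = π ^ 4 / 120`, by telescoping the squares of the partial sums
of `ζ(2)`. -/
theorem hasSum_harmonicSq_div_sq :
    HasSum (fun k => harmonicSq k / ((k : ℝ) + 1) ^ 2) (Real.pi ^ 4 / 120) := by
  have hN : ∀ N, ∑ k ∈ Finset.range N, harmonicSq k / ((k : ℝ) + 1) ^ 2 =
      (harmonicSq N ^ 2 - ∑ k ∈ Finset.range N, 1 / ((k : ℝ) + 1) ^ 4) / 2 := by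
    intro N
    induction N with
    | zero => simp [harmonicSq]
    | succ N ih =>
      rw [Finset.sum_range_succ, ih, Finset.sum_range_succ _ N, harmonicSq_succ]
      field_simp
      ring
  rw [hasSum_iff_tendsto_nat_of_nonneg
    fun k => div_nonneg (harmonicSq_nonneg k) (by positivity)]
  simp only [hN]
  have h := ((hasSum_one_div_succ_sq.tendsto_sum_nat.pow 2).sub
    hasSum_one_div_succ_pow_four.tendsto_sum_nat).div_const 2
  rwa [show ((Real.pi ^ 2 / 6) ^ 2 - Real.pi ^ 4 / 90) / 2 = Real.pi ^ 4 / 120 by ring] at h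

theorem tendsto_polylogTwoTwo_nhdsLT_one :
    Tendsto polylogTwoTwo (𝓝[<] 1) (𝓝 (Real.pi ^ 4 / 120)) := by
  rw [← hasSum_harmonicSq_div_sq.tsum_eq]
  exact tendsto_tsum_mul_pow_nhdsLT_one hasSum_harmonicSq_div_sq.summable
    fun k => div_nonneg (harmonicSq_nonneg k) (by positivity)

/-! ### Functional equations -/

theorem hasDerivAt_log_one_sub {t : ℝ} (ht : t < 1) :
    HasDerivAt (fun t : ℝ => Real.log (1 - t)) (-1 / (1 - t)) t :=
  ((hasDerivAt_id t).const_sub 1).log (sub_pos.2 ht).ne'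

theorem hasDerivAt_polylog_two {t : ℝ} (ht : t < 1) (ht0 : t ≠ 0) :
    HasDerivAt (polylog 2) (-Real.log (1 - t) / t) t := by
  rw [← polylog_one ht]
  exact hasDerivAt_polylog_succ 1 ht ht0

theorem hasDerivAt_polylog_succ_one_sub (n : ℕ) {t : ℝ} (ht : t ∈ Ioo (0 : ℝ) 1) :
    HasDerivAt (fun t => polylog (n + 1) (1 - t)) (-(polylog n (1 - t) / (1 - t))) t := by
  have h := (hasDerivAt_polylog_succ n (by linarith [ht.1] : 1 - t < 1)
    (sub_pos.2 ht.2).ne').comp t ((hasDerivAt_id t).const_sub 1)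
  simpa using! h

theorem hasDerivAt_polylog_succ_div_sub_one (n : ℕ) {t : ℝ} (ht : t ∈ Ioo (0 : ℝ) 1) :
    HasDerivAt (fun t => polylog (n + 1) (t / (t - 1)))
      (polylog n (t / (t - 1)) * (1 / t + 1 / (1 - t))) t := by
  have h0 := ht.1.ne'
  have h1 : t - 1 ≠ 0 := (sub_neg.2 ht.2).ne
  have h1' : 1 - t ≠ 0 := (sub_pos.2 ht.2).ne'
  have hs : t / (t - 1) < 0 := div_neg_of_pos_of_neg ht.1 (sub_neg.2 ht.2)
  have h := (hasDerivAt_polylog_succ n (hs.trans one_pos) hs.ne).comp t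
    ((hasDerivAt_id t).div ((hasDerivAt_id t).sub_const 1) h1)
  refine h.congr_deriv ?_
  generalize polylog n (t / (t - 1)) = p
  simp only [id]
  rw [← neg_sub t 1] at h1' ⊢
  field_simp
  ring

theorem tendsto_div_sub_one_nhdsGT_zero :
    Tendsto (fun t : ℝ => t / (t - 1)) (𝓝[>] 0) (𝓝 0) := by
  have h : ContinuousAt (fun t : ℝ => t / (t - 1)) 0 :=
    continuousAt_id.div (continuousAt_id.sub continuousAt_const) (by norm_num)
  simpa [ContinuousAt] using h.tendsto.mono_left (nhdsWithin_le_nhds (s := Ioi 0))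

theorem tendsto_polylog_nhdsGT_zero (n : ℕ) : Tendsto (polylog n) (𝓝[>] 0) (𝓝 0) := by
  simpa [polylog_zero] using
    (continuousAt_polylog n one_pos).tendsto.mono_left (nhdsWithin_le_nhds (s := Ioi 0))

theorem tendsto_polylog_div_sub_one_nhdsGT_zero (n : ℕ) :
    Tendsto (fun t => polylog n (t / (t - 1))) (𝓝[>] 0) (𝓝 0) := by
  have h := (continuousAt_polylog n one_pos).tendsto
  rw [polylog_zero] at h
  exact h.comp tendsto_div_sub_one_nhdsGT_zero

theorem tendsto_log_one_sub_nhdsGT_zero :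
    Tendsto (fun t : ℝ => Real.log (1 - t)) (𝓝[>] 0) (𝓝 0) := by
  simpa using (hasDerivAt_log_one_sub one_pos).continuousAt.tendsto.mono_left
    (nhdsWithin_le_nhds (s := Ioi 0))

/-- A function on `(0, 1)` with zero derivative equals its limit at an endpoint. All functional
equations below are proved in this way. -/
theorem eq_of_hasDerivAt_zero_of_tendsto {f : ℝ → ℝ} {l : Filter ℝ} [l.NeBot] {b : ℝ}
    (hf : ∀ t ∈ Ioo (0 : ℝ) 1, HasDerivAt f 0 t) (hl : Ioo (0 : ℝ) 1 ∈ l)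
    (hlim : Tendsto f l (𝓝 b)) {t : ℝ} (ht : t ∈ Ioo (0 : ℝ) 1) : f t = b := by
  refine tendsto_nhds_unique (tendsto_const_nhds.congr' ?_) hlim
  filter_upwards [hl] with y hy
  exact isOpen_Ioo.is_const_of_deriv_eq_zero isPreconnected_Ioo
    (fun x hx => (hf x hx).differentiableAt.differentiableWithinAt) (fun x hx => (hf x hx).deriv)
    ht hy

/-- Euler's reflection formula for the dilogarithm. -/
theorem polylog_two_one_sub {t : ℝ} (ht : t ∈ Ioo (0 : ℝ) 1) :
    polylog 2 (1 - t) = Real.pi ^ 2 / 6 - Real.log t * Real.log (1 - t) - polylog 2 t := by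
  have h := eq_of_hasDerivAt_zero_of_tendsto (l := 𝓝[>] 0)
    (f := fun t => polylog 2 (1 - t) + Real.log t * Real.log (1 - t) + polylog 2 t)
    (b := Real.pi ^ 2 / 6 + 0 + 0) (fun t ht => ?_) (Ioo_mem_nhdsGT one_pos)
    (((tendsto_polylog_two_nhdsLT_one.comp tendsto_one_sub_nhdsGT_zero).add
      tendsto_log_mul_log_one_sub).add (tendsto_polylog_nhdsGT_zero 2)) ht
  · linarith
  · have h0 := ht.1.ne'
    have h1 : 1 - t ≠ 0 := (sub_pos.2 ht.2).ne'
    refine (((hasDerivAt_polylog_succ_one_sub 1 ht).add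
      ((Real.hasDerivAt_log h0).mul (hasDerivAt_log_one_sub ht.2))).add
      (hasDerivAt_polylog_two ht.2 h0)).congr_deriv ?_
    rw [polylog_one (by linarith [ht.1]), sub_sub_cancel]
    field_simp
    ring

/-- Landen's formula for the dilogarithm. -/
theorem polylog_two_div_sub_one {t : ℝ} (ht : t ∈ Ioo (0 : ℝ) 1) :
    polylog 2 (t / (t - 1)) = -polylog 2 t - 1 / 2 * Real.log (1 - t) ^ 2 := by
  have h := eq_of_hasDerivAt_zero_of_tendsto (l := 𝓝[>] 0)
    (f := fun t => polylog 2 (t / (t - 1)) + polylog 2 t + 1 / 2 * Real.log (1 - t) ^ 2)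
    (b := 0 + 0 + 1 / 2 * 0 ^ 2) (fun t ht => ?_) (Ioo_mem_nhdsGT one_pos)
    (((tendsto_polylog_div_sub_one_nhdsGT_zero 2).add (tendsto_polylog_nhdsGT_zero 2)).add
      ((tendsto_log_one_sub_nhdsGT_zero.pow 2).const_mul (1 / 2))) ht
  · linarith
  · have h0 := ht.1.ne'
    have h1 : 1 - t ≠ 0 := (sub_pos.2 ht.2).ne'
    have h1' : t - 1 ≠ 0 := (sub_neg.2 ht.2).ne
    have hs : t / (t - 1) < 0 := div_neg_of_pos_of_neg ht.1 (sub_neg.2 ht.2)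
    have hl : Real.log (1 - t / (t - 1)) = -Real.log (1 - t) := by
      rw [← Real.log_inv]
      congr 1
      rw [eq_comm, inv_eq_iff_eq_inv, ← neg_sub t 1]
      field_simp
      ring
    refine (((hasDerivAt_polylog_succ_div_sub_one 1 ht).add
      (hasDerivAt_polylog_two ht.2 h0)).add
      (((hasDerivAt_log_one_sub ht.2).pow 2).const_mul (1 / 2))).congr_deriv ?_
    rw [polylog_one (by linarith), hl]
    field_simp
    ring

/-- Landen's three-term formula for the trilogarithm. -/
theorem polylog_three_div_sub_one {t : ℝ} (ht : t ∈ Ioo (0 : ℝ) 1) :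
    polylog 3 (t / (t - 1)) = -polylog 3 (1 - t) - polylog 3 t + 1 / 6 * Real.log (1 - t) ^ 3
      + Real.pi ^ 2 / 6 * Real.log (1 - t) - 1 / 2 * (Real.log t * Real.log (1 - t) ^ 2)
      + (riemannZeta 3).re := by
  have hlim : Tendsto (fun t : ℝ => Real.log t * Real.log (1 - t) ^ 2) (𝓝[>] 0) (𝓝 (0 * 0)) :=
    (tendsto_log_mul_log_one_sub.mul tendsto_log_one_sub_nhdsGT_zero).congr fun t => by ring
  have h := eq_of_hasDerivAt_zero_of_tendsto (l := 𝓝[>] 0)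
    (f := fun t => polylog 3 (t / (t - 1)) + polylog 3 (1 - t) + polylog 3 t
      - 1 / 6 * Real.log (1 - t) ^ 3 - Real.pi ^ 2 / 6 * Real.log (1 - t)
      + 1 / 2 * (Real.log t * Real.log (1 - t) ^ 2))
    (b := 0 + (riemannZeta 3).re + 0 - 1 / 6 * 0 ^ 3 - Real.pi ^ 2 / 6 * 0 + 1 / 2 * (0 * 0))
    (fun t ht => ?_) (Ioo_mem_nhdsGT one_pos)
    ((((((tendsto_polylog_div_sub_one_nhdsGT_zero 3).add
      (tendsto_polylog_three_nhdsLT_one.comp tendsto_one_sub_nhdsGT_zero)).add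
      (tendsto_polylog_nhdsGT_zero 3)).sub
      ((tendsto_log_one_sub_nhdsGT_zero.pow 3).const_mul (1 / 6))).sub
      (tendsto_log_one_sub_nhdsGT_zero.const_mul (Real.pi ^ 2 / 6))).add
      (hlim.const_mul (1 / 2))) ht
  · linarith
  · have h0 := ht.1.ne'
    have h1 : 1 - t ≠ 0 := (sub_pos.2 ht.2).ne'
    have hB := hasDerivAt_log_one_sub ht.2
    refine ((((((hasDerivAt_polylog_succ_div_sub_one 2 ht).add
      (hasDerivAt_polylog_succ_one_sub 2 ht)).add
      (hasDerivAt_polylog_succ 2 ht.2 h0)).sub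
      ((hB.pow 3).const_mul (1 / 6))).sub
      (hB.const_mul (Real.pi ^ 2 / 6))).add
      (((Real.hasDerivAt_log h0).mul (hB.pow 2)).const_mul (1 / 2))).congr_deriv ?_
    rw [polylog_two_div_sub_one ht, polylog_two_one_sub ht]
    simp only [Pi.pow_apply]
    generalize polylog 2 t = p
    generalize Real.log (1 - t) = b
    generalize Real.log t = a
    push_cast
    field_simp
    ring

/-- Reduction of the weight-three multiple polylogarithm `Li_{1,2}` to classical polylogarithms. -/
theorem polylogOneTwo_one_sub {t : ℝ} (ht : t ∈ Ioo (0 : ℝ) 1) :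
    polylogOneTwo (1 - t) = 2 * polylog 3 t - 2 * (riemannZeta 3).re
      - Real.log t * (Real.pi ^ 2 / 6 + polylog 2 t) := by
  have hlog : Tendsto Real.log (𝓝[<] 1) (𝓝 0) := by
    simpa using (Real.continuousAt_log one_ne_zero).tendsto.mono_left
      (nhdsWithin_le_nhds (s := Iio 1))
  have hone : Tendsto (fun t : ℝ => polylogOneTwo (1 - t)) (𝓝[<] 1) (𝓝 0) := by
    have h0 : polylogOneTwo 0 = 0 := by simp [polylogOneTwo]
    have hc := (hasDerivAt_polylogOneTwo (x := 0) (by simp)).continuousAt.tendsto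
    rw [h0] at hc
    refine hc.comp ?_
    have : Tendsto (fun t : ℝ => 1 - t) (𝓝 1) (𝓝 (1 - 1)) :=
      (continuous_const.sub continuous_id).tendsto 1
    simpa using this.mono_left (nhdsWithin_le_nhds (s := Iio 1))
  have h := eq_of_hasDerivAt_zero_of_tendsto (l := 𝓝[<] 1)
    (f := fun t => polylogOneTwo (1 - t) - 2 * polylog 3 t
      + Real.log t * (Real.pi ^ 2 / 6 + polylog 2 t))
    (b := 0 - 2 * (riemannZeta 3).re + 0 * (Real.pi ^ 2 / 6 + Real.pi ^ 2 / 6))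
    (fun t ht => ?_) (Ioo_mem_nhdsLT one_pos)
    ((hone.sub (tendsto_polylog_three_nhdsLT_one.const_mul 2)).add
      (hlog.mul (tendsto_polylog_two_nhdsLT_one.const_add (Real.pi ^ 2 / 6)))) ht
  · linarith
  · have h0 := ht.1.ne'
    have hx : |1 - t| < 1 := abs_lt.2 ⟨by linarith [ht.2], by linarith [ht.1]⟩
    refine ((((hasDerivAt_polylogOneTwo hx).comp t ((hasDerivAt_id t).const_sub 1)).sub
      ((hasDerivAt_polylog_succ 2 ht.2 h0).const_mul 2)).add
      ((Real.hasDerivAt_log h0).mul ((hasDerivAt_polylog_two ht.2 h0).const_add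
        (Real.pi ^ 2 / 6)))).congr_deriv ?_
    rw [polylog_two_one_sub ht, sub_sub_cancel]
    field_simp
    ring

/-- Reduction of the weight-four multiple polylogarithm `Li_{2,2}` to classical polylogarithms. -/
theorem polylogTwoTwo_one_sub {t : ℝ} (ht : t ∈ Ioo (0 : ℝ) 1) :
    polylogTwoTwo (1 - t) = Real.pi ^ 4 / 360 + Real.pi ^ 4 / 36
      + 1 / 2 * polylog 2 t ^ 2 - Real.pi ^ 2 / 6 * polylog 2 t
      + 2 * polylog 4 t - 2 * polylog 4 (1 - t)
      + 2 * (Real.log t * (polylog 3 (1 - t) - (riemannZeta 3).re))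
      + 1 / 12 * Real.log (1 - t) ^ 4 + Real.pi ^ 2 / 6 * Real.log (1 - t) ^ 2
      + 2 * polylog 4 (t / (t - 1))
      + Real.log t * Real.log (1 - t) *
          (polylog 2 t - Real.pi ^ 2 / 2 - 1 / 3 * Real.log (1 - t) ^ 2
            + Real.log t * Real.log (1 - t)) := by
  have hB := tendsto_log_one_sub_nhdsGT_zero
  have hAB := tendsto_log_mul_log_one_sub
  have h2 := tendsto_polylog_nhdsGT_zero 2
  have h := eq_of_hasDerivAt_zero_of_tendsto (l := 𝓝[>] 0)
    (f := fun t => 1 / 2 * polylog 2 t ^ 2 - Real.pi ^ 2 / 6 * polylog 2 t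
      + 2 * polylog 4 t - 2 * polylog 4 (1 - t)
      + 2 * (Real.log t * (polylog 3 (1 - t) - (riemannZeta 3).re))
      + 1 / 12 * Real.log (1 - t) ^ 4 + Real.pi ^ 2 / 6 * Real.log (1 - t) ^ 2
      + 2 * polylog 4 (t / (t - 1))
      + Real.log t * Real.log (1 - t) *
          (polylog 2 t - Real.pi ^ 2 / 2 - 1 / 3 * Real.log (1 - t) ^ 2
            + Real.log t * Real.log (1 - t)) - polylogTwoTwo (1 - t))
    (b := 1 / 2 * 0 ^ 2 - Real.pi ^ 2 / 6 * 0 + 2 * 0 - 2 * (Real.pi ^ 4 / 90) + 2 * 0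
      + 1 / 12 * 0 ^ 4 + Real.pi ^ 2 / 6 * 0 ^ 2 + 2 * 0
      + 0 * (0 - Real.pi ^ 2 / 2 - 1 / 3 * 0 ^ 2 + 0) - Real.pi ^ 4 / 120)
    (fun t ht => ?_) (Ioo_mem_nhdsGT one_pos)
    ((((((((((h2.pow 2).const_mul (1 / 2)).sub (h2.const_mul (Real.pi ^ 2 / 6))).add
      ((tendsto_polylog_nhdsGT_zero 4).const_mul 2)).sub
      ((tendsto_polylog_four_nhdsLT_one.comp tendsto_one_sub_nhdsGT_zero).const_mul 2)).add
      (tendsto_log_mul_polylog_three_one_sub.const_mul 2)).add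
      ((hB.pow 4).const_mul (1 / 12))).add
      ((hB.pow 2).const_mul (Real.pi ^ 2 / 6))).add
      ((tendsto_polylog_div_sub_one_nhdsGT_zero 4).const_mul 2)).add
      (hAB.mul (((h2.sub_const (Real.pi ^ 2 / 2)).sub ((hB.pow 2).const_mul (1 / 3))).add
        hAB))
      |>.sub (tendsto_polylogTwoTwo_nhdsLT_one.comp tendsto_one_sub_nhdsGT_zero)) ht
  · linarith
  · have h0 := ht.1.ne'
    have h1 : 1 - t ≠ 0 := (sub_pos.2 ht.2).ne'
    have hx : |1 - t| < 1 := abs_lt.2 ⟨by linarith [ht.2], by linarith [ht.1]⟩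
    have dA := Real.hasDerivAt_log h0
    have dB := hasDerivAt_log_one_sub ht.2
    have d2 := hasDerivAt_polylog_two ht.2 h0
    have dAB := dA.mul dB
    refine ((((((((((d2.pow 2).const_mul (1 / 2)).sub (d2.const_mul (Real.pi ^ 2 / 6))).add
      ((hasDerivAt_polylog_succ 3 ht.2 h0).const_mul 2)).sub
      ((hasDerivAt_polylog_succ_one_sub 3 ht).const_mul 2)).add
      ((dA.mul ((hasDerivAt_polylog_succ_one_sub 2 ht).sub_const
        (riemannZeta 3).re)).const_mul 2)).add
      ((dB.pow 4).const_mul (1 / 12))).add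
      ((dB.pow 2).const_mul (Real.pi ^ 2 / 6))).add
      ((hasDerivAt_polylog_succ_div_sub_one 3 ht).const_mul 2)).add
      (dAB.mul (((d2.sub_const (Real.pi ^ 2 / 2)).sub ((dB.pow 2).const_mul (1 / 3))).add
        dAB))
      |>.sub ((hasDerivAt_polylogTwoTwo hx h1).comp t ((hasDerivAt_id t).const_sub 1))
      ).congr_deriv ?_
    rw [polylog_three_div_sub_one ht, polylog_two_one_sub ht, polylogOneTwo_one_sub ht]
    simp only [Pi.pow_apply, Pi.mul_apply, Pi.add_apply, Pi.sub_apply]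
    generalize polylog 2 t = p2
    generalize polylog 3 t = p3
    generalize polylog 3 (1 - t) = q3
    generalize Real.log (1 - t) = b
    generalize Real.log t = a
    push_cast
    field_simp
    ring

end Polylogarithms

theorem mainTheorem1 :
    (∀ z : ℝ, -1 < z → z ≤ 1 → ContDiffAt ℝ 4 (fun ν : ℝ => legendreP ν z) 0) ∧
    (∀ z t : ℝ, -1 < z → z < 1 → t = (1 + z) / 2 →
      legendreOrderDeriv 4 z =
        Real.pi ^ 4 / 15 + 24 *
          (Real.pi ^ 4 / 36
            + 1 / 2 * polylog 2 t ^ 2 - Real.pi ^ 2 / 6 * polylog 2 t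
            + 2 * polylog 4 t - 2 * polylog 4 (1 - t)
            + 2 * Real.log t * (polylog 3 (1 - t) - (riemannZeta 3).re)
            + 1 / 12 * Real.log (1 - t) ^ 4 + Real.pi ^ 2 / 6 * Real.log (1 - t) ^ 2
            + 2 * polylog 4 (t / (t - 1))
            + Real.log t * Real.log (1 - t) *
                (polylog 2 t - Real.pi ^ 2 / 2 - 1 / 3 * Real.log (1 - t) ^ 2
                  + Real.log t * Real.log (1 - t)))) ∧
    legendreOrderDeriv 4 1 = 0 ∧
    Filter.Tendsto (legendreOrderDeriv 4) (nhdsWithin 1 (Set.Iio 1)) (nhds 0) := by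
  have hP : ∀ z : ℝ, -1 < z → z ≤ 1 →
      legendreOrderDeriv 4 z = 24 * polylogTwoTwo ((1 - z) / 2) :=
    fun z hz hz' => (contDiffAt_legendreP_and_orderDeriv_four hz hz').2
  have h0 : polylogTwoTwo 0 = 0 := by simp [polylogTwoTwo]
  refine ⟨fun z hz hz' => (contDiffAt_legendreP_and_orderDeriv_four hz hz').1,
    fun z t hz hz' ht => ?_, ?_, ?_⟩
  · -- here `(1 - z) / 2 = 1 - t`, and `24 * (π ^ 4 / 360)` is the constant `π ^ 4 / 15`
    have htI : t ∈ Set.Ioo (0 : ℝ) 1 := ⟨by linarith, by linarith⟩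
    rw [hP z hz hz'.le, show (1 - z) / 2 = 1 - t by rw [ht]; ring, polylogTwoTwo_one_sub htI]
    ring
  · rw [hP 1 (by norm_num) le_rfl]
    simp [h0]
  · have hc : ContinuousAt polylogTwoTwo 0 :=
      (hasDerivAt_polylogTwoTwo_tsum (by simp)).continuousAt
    have hlin : Filter.Tendsto (fun z : ℝ => (1 - z) / 2) (nhdsWithin 1 (Set.Iio 1)) (nhds 0) := by
      have : Continuous fun z : ℝ => (1 - z) / 2 := by fun_prop
      simpa using (this.tendsto 1).mono_left (nhdsWithin_le_nhds (s := Set.Iio 1))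
    have h := ((hc.tendsto.comp hlin).const_mul 24)
    rw [h0, mul_zero] at h
    refine h.congr' ?_
    filter_upwards [Ioo_mem_nhdsLT (by norm_num : (-1 : ℝ) < 1)] with z hz
    exact (hP z hz.1 hz.2.le).symm
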